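/- Let $R$ be a commutative ring with identity and let $n\ge 0$ be an integer. Write $\mathrm{fd}_R$ for flat dimension. An $R$-module $M$ is *Gorenstein flat* if there is an exact sequence of flat $R$-modules $\cdots\to F_1\to F_0\xrightarrow{f_0} F^0\to F^1\to\cdots$ that stays exact after applying $-\otimes_R I$ for every injective $R$-module $I$ and satisfies $M\cong\operatorname{Im}(f_0)$. The Gorenstein flat dimension $\mathrm{Gfd}_R(M)$ is the least length $m$ of an exact sequence $0\to G_m\to\cdots\to G_0\to M\to 0$ with all $G_i$ Gorenstein flat ($\infty$ if there is none), and $\mathrm{wGgldim}(R)=\sup\{\mathrm{Gfd}_R(M)\mid M \text{ an } R\text{-module}\}$. A module $M$ is *strongly $n$-Gorenstein flat* if there is a short exact sequence $0\to M\to F\to M\to 0$ with $\mathrm{fd}_R(F)\le n$, and $\mathrm{Tor}^R_{n+1}(M,I)=0$ for every injective $R$-module $I$. The ring $R$ is *weakly $n$-strongly Gorenstein* ($n$-wSG) if every $R$-module is strongly $n$-Gorenstein flat. It is *coherent* if every finitely generated ideal is finitely presented. Consider the following assertions: 1. $R$ is an $n$-wSG ring. 2. $\mathrm{wGgldim}(R)\le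 n$ and for every $R$-module $M$ there is a short exact sequence $0\to M\to F\to M\to 0$ with $\mathrm{fd}_R(F)<\infty$. 3. $\mathrm{wGgldim}(R)<\infty$ and for every $R$-module $M$ there is a short exact sequence $0\to M\to F\to M\to 0$ with $\mathrm{fd}_R(F)\le n$. 4. For every $R$-module $M$ there is a short exact sequence $0\to M\to F\to M\to 0$ with $\mathrm{fd}_R(F)\le n$. Then (1), (2) and (3) are equivalent, and each of them implies (4). If $R$ is coherent, then (4) is equivalent to (1), (2) and (3). -/

import Mathlib

open CategoryTheory TensorProduct

universe u

noncomputable section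

namespace GorRing

/-- `M` admits an exact sequence `0 → X n → ⋯ → X 1 → X 0 → M → 0` in which every `X i`
belongs to the class `P` of `R`-modules. -/
def HasResolutionLE (R : Type u) [CommRing R] (P : ModuleCat.{u} R → Prop)
    (M : Type u) [AddCommGroup M] [Module R M] (n : ℕ) : Prop :=
  ∃ (X : ℕ → ModuleCat.{u} R) (d : ∀ i, X (i + 1) →ₗ[R] X i) (ε : X 0 →ₗ[R] M),
    Function.Surjective ε ∧
    Function.Exact (d 0) ε ∧
    (∀ i, Function.Exact (d (i + 1)) (d i)) ∧
    (∀ i, i ≤ n → P (X i)) ∧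
    (∀ i, n < i → Subsingleton (X i))

/-- The least length of a resolution of `M` by modules of the class `P`, and `⊤` if there is no
such resolution of finite length. -/
def resolutionDim (R : Type u) [CommRing R] (P : ModuleCat.{u} R → Prop)
    (M : Type u) [AddCommGroup M] [Module R M] : ℕ∞ :=
  ⨅ (n : ℕ) (_ : HasResolutionLE R P M n), (n : ℕ∞)

/-- The flat dimension `fd_R(M)`. -/
def flatDim (R : Type u) [CommRing R] (M : Type u) [AddCommGroup M] [Module R M] : ℕ∞ :=
  resolutionDim R (fun X => Module.Flat R X) M

/-- `M` is Gorenstein flat: there is an exact sequence `⋯ → F (-1) → F 0 → F 1 → ⋯` of flat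
modules which stays exact after tensoring with any injective module, such that `M` is isomorphic
to the image of one of its maps. -/
def IsGorensteinFlat (R : Type u) [CommRing R] (M : Type u) [AddCommGroup M] [Module R M] :
    Prop :=
  ∃ (F : ℤ → ModuleCat.{u} R) (d : ∀ i, F i →ₗ[R] F (i + 1)),
    (∀ i, Module.Flat R (F i)) ∧
    (∀ i, Function.Exact (d i) (d (i + 1))) ∧
    (∀ (I : Type u) [AddCommGroup I] [Module R I], Module.Injective R I →
      ∀ i, Function.Exact ((d i).rTensor I) ((d (i + 1)).rTensor I)) ∧
    Nonempty (M ≃ₗ[R] LinearMap.range (d 0))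

/-- The Gorenstein flat dimension `Gfd_R(M)`. -/
def gorensteinFlatDim (R : Type u) [CommRing R] (M : Type u) [AddCommGroup M] [Module R M] :
    ℕ∞ :=
  resolutionDim R (fun X => IsGorensteinFlat R X) M

/-- The weak Gorenstein global dimension `wGgldim(R)`. -/
def weakGorensteinGlobalDim (R : Type u) [CommRing R] : ℕ∞ :=
  ⨆ M : ModuleCat.{u} R, gorensteinFlatDim R M

/-- There is a short exact sequence `0 → M → F → M → 0` whose middle term has a flat dimension
satisfying the predicate `p`. -/
def HasSelfExtension (R : Type u) [CommRing R] (M : Type u) [AddCommGroup M] [Module R M]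
    (p : ℕ∞ → Prop) : Prop :=
  ∃ (F : ModuleCat.{u} R) (f : M →ₗ[R] F) (g : F →ₗ[R] M),
    Function.Injective f ∧ Function.Exact f g ∧ Function.Surjective g ∧ p (flatDim R F)

/-- `M` is strongly `n`-Gorenstein flat: there is a short exact sequence `0 → M → F → M → 0` with
`fd_R(F) ≤ n`, and `Tor_{n+1}(M, I) = 0` for every injective module `I`. -/
def IsStronglyGorensteinFlat (R : Type u) [CommRing R] (n : ℕ)
    (M : Type u) [AddCommGroup M] [Module R M] : Prop :=
  HasSelfExtension R M (fun k => k ≤ (n : ℕ∞)) ∧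
  ∀ (I : Type u) [AddCommGroup I] [Module R I], Module.Injective R I →
    Subsingleton (((Tor (ModuleCat.{u} R) (n + 1)).obj (ModuleCat.of R M)).obj
      (ModuleCat.of R I))

/-- `R` is a weakly `n`-strongly Gorenstein ring (`n`-wSG ring). -/
def IsWeaklyStronglyGorenstein (R : Type u) [CommRing R] (n : ℕ) : Prop :=
  ∀ (M : Type u) [AddCommGroup M] [Module R M], IsStronglyGorensteinFlat R n M

/-- `R` is coherent: every finitely generated ideal is finitely presented. -/
def IsCoherentRing (R : Type u) [CommRing R] : Prop :=
  ∀ I : Ideal R, I.FG → Module.FinitePresentation R I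

end GorRing

end

noncomputable section

namespace GorRing

variable {R : Type u} [CommRing R]

/-! ### Vanishing of `Tor` through iterated syzygies -/

section TorVanishing

variable {A B C K L M N P Q : Type u}
  [AddCommGroup A] [Module R A] [AddCommGroup B] [Module R B] [AddCommGroup C] [Module R C]
  [AddCommGroup K] [Module R K] [AddCommGroup L] [Module R L]
  [AddCommGroup M] [Module R M] [AddCommGroup N] [Module R N]
  [AddCommGroup P] [Module R P] [AddCommGroup Q] [Module R Q]

/-! Everything follows from self-extensions `0 → M → F → M → 0` with `fd F ≤ n`. For injective `I`
the self-extension splits, so `I` is a retract of `F` and `fd I ≤ n`; hence `Tor_{n+1}(M, I) = 0`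
for every `M` (`HasSelfExtension.torVanish_of_injective`). This is all that (1) adds to (4).

To get `wGgldim R ≤ n`, the horseshoe lemma passes a self-extension to syzygies and lowers `fd F` by
one. After `n` syzygies the middle term is flat, and splicing copies of the extension gives a
periodic complex, exact against injectives because `Tor₁` vanishes there
(`HasSelfExtension.hasResolutionLE`).

For (2) → (3), `Gfd F ≤ n` kills `Tor` of `F` against injectives above degree `n`. Embedding an
arbitrary module in an injective then lowers a finite `fd F` step by step to `n`
(`flatDim_le_of_gorensteinFlatDim_le`).

`TorVanish R k` means vanishing of `Tor_{k+1}`, so `fd M ≤ n` is `TorVanish R n M N` for all `N`. -/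

theorem rTensor_lTensor_apply (f : A →ₗ[R] B) (g : L →ₗ[R] Q) (x : A ⊗[R] L) :
    f.rTensor Q (g.lTensor A x) = g.lTensor B (f.rTensor L x) := by
  rw [← LinearMap.comp_apply, ← LinearMap.comp_apply, LinearMap.rTensor_comp_lTensor,
    LinearMap.lTensor_comp_rTensor]

theorem lTensor_injective_iff_rTensor (f : A →ₗ[R] B) :
    Function.Injective (f.lTensor N) ↔ Function.Injective (f.rTensor N) := by
  have h : f.rTensor N ∘ₗ (TensorProduct.comm R N A).toLinearMap =
      (TensorProduct.comm R N B).toLinearMap ∘ₗ f.lTensor N := by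
    ext; simp
  have h' : ⇑(f.rTensor N) ∘ TensorProduct.comm R N A =
      TensorProduct.comm R N B ∘ f.lTensor N := congrArg DFunLike.coe h
  rw [← (TensorProduct.comm R N B).injective.of_comp_iff, ← h',
    Function.Injective.of_comp_iff' _ (TensorProduct.comm R N A).bijective]

/-- Balancing of `Tor₁`: if `0 → K → P → M → 0` has flat middle term and stays exact after
tensoring with `N`, then every `0 → L → Q → N → 0` stays exact after tensoring with `M`. -/
theorem lTensor_injective_of_rTensor_injective [Module.Flat R P]
    {i : K →ₗ[R] P} {p : P →ₗ[R] M} (hip : Function.Exact i p) (hp : Function.Surjective p)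
    {j : L →ₗ[R] Q} {q : Q →ₗ[R] N} (hj : Function.Injective j) (hjq : Function.Exact j q)
    (hq : Function.Surjective q) (h : Function.Injective (i.rTensor N)) :
    Function.Injective (j.lTensor M) := by
  rw [injective_iff_map_eq_zero]
  intro z hz
  obtain ⟨w, rfl⟩ := LinearMap.rTensor_surjective L hp z
  rw [← rTensor_lTensor_apply] at hz
  obtain ⟨v, hv⟩ := (rTensor_exact Q hip hp _).1 hz
  have hv0 : q.lTensor K v = 0 := by
    apply h
    rw [rTensor_lTensor_apply, hv, map_zero]
    exact (lTensor_exact P hjq hq).apply_apply_eq_zero w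
  obtain ⟨t, rfl⟩ := (lTensor_exact K hjq hq _).1 hv0
  rw [rTensor_lTensor_apply] at hv
  have := Module.Flat.lTensor_preserves_injective_linearMap (M := P) j hj hv
  rw [← this]
  exact (rTensor_exact L hip hp).apply_apply_eq_zero t

variable (R M) in
/-- The canonical free module mapping onto `M`. -/
def FreeCover : Type u := M →₀ R

instance : AddCommGroup (FreeCover R M) := inferInstanceAs (AddCommGroup (M →₀ R))

instance : Module R (FreeCover R M) := inferInstanceAs (Module R (M →₀ R))

instance : Module.Free R (FreeCover R M) := inferInstanceAs (Module.Free R (M →₀ R))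

variable (R M) in
/-- The canonical surjection from a free module onto `M`. -/
def freeCoverMap : FreeCover R M →ₗ[R] M := Finsupp.linearCombination R (id : M → M)

variable (R M) in
/-- The first syzygy of `M` for its canonical presentation by a free module. -/
def syzygy : Submodule R (FreeCover R M) := LinearMap.ker (freeCoverMap R M)

theorem syzygy_surjective : Function.Surjective (freeCoverMap R M) :=
  Finsupp.linearCombination_id_surjective R M

theorem syzygy_exact : Function.Exact (syzygy R M).subtype (freeCoverMap R M) :=
  LinearMap.exact_subtype_ker_map _

variable (R M N) in
/-- `Tor₁ M N` vanishes. -/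
structure TorOneVanish : Prop where
  injective : Function.Injective ((syzygy R M).subtype.rTensor N)

variable (R) in
/-- `TorVanish R k M N` expresses that `Tor (k + 1) M N` vanishes, in terms of iterated
syzygies of `M`. -/
def TorVanish : ℕ → ∀ (M : Type u) [AddCommGroup M] [Module R M] (N : Type u) [AddCommGroup N]
    [Module R N], Prop
  | 0, M, _, _, N, _, _ => TorOneVanish R M N
  | k + 1, M, _, _, N, _, _ => TorVanish k (syzygy R M) N

theorem TorOneVanish.lTensor_injective (h : TorOneVanish R M N)
    {j : L →ₗ[R] Q} {q : Q →ₗ[R] N} (hj : Function.Injective j) (hjq : Function.Exact j q)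
    (hq : Function.Surjective q) : Function.Injective (j.lTensor M) :=
  lTensor_injective_of_rTensor_injective syzygy_exact syzygy_surjective hj hjq hq h.1

theorem TorOneVanish.symm (h : TorOneVanish R M N) : TorOneVanish R N M where
  injective := (lTensor_injective_iff_rTensor _).1 <|
    h.lTensor_injective (syzygy R N).injective_subtype syzygy_exact syzygy_surjective

theorem TorOneVanish.rTensor_injective (h : TorOneVanish R M N)
    {j : L →ₗ[R] Q} {q : Q →ₗ[R] M} (hj : Function.Injective j) (hjq : Function.Exact j q)
    (hq : Function.Surjective q) : Function.Injective (j.rTensor N) :=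
  (lTensor_injective_iff_rTensor _).1 <| h.symm.lTensor_injective hj hjq hq

/-- Balancing makes the choice of presentation irrelevant: one flat presentation suffices to test
`Tor₁`. -/
theorem torOneVanish_of_rTensor_injective [Module.Flat R P]
    {i : K →ₗ[R] P} {p : P →ₗ[R] M} (hip : Function.Exact i p) (hp : Function.Surjective p)
    (h : Function.Injective (i.rTensor N)) : TorOneVanish R M N :=
  TorOneVanish.symm <| .mk <| (lTensor_injective_iff_rTensor _).1 <|
    lTensor_injective_of_rTensor_injective hip hp (syzygy R N).injective_subtype syzygy_exact
      syzygy_surjective h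

theorem torOneVanish_of_lTensor_injective [Module.Flat R P]
    {i : K →ₗ[R] P} {p : P →ₗ[R] N} (hip : Function.Exact i p) (hp : Function.Surjective p)
    (h : Function.Injective (i.lTensor M)) : TorOneVanish R M N :=
  (torOneVanish_of_rTensor_injective hip hp ((lTensor_injective_iff_rTensor _).1 h)).symm

theorem flat_iff_torOneVanish :
    Module.Flat R M ↔ ∀ (N : Type u) [AddCommGroup N] [Module R N], TorOneVanish R M N := by
  constructor
  · intro _ N _ _
    exact torOneVanish_of_lTensor_injective syzygy_exact syzygy_surjective
      (Module.Flat.lTensor_preserves_injective_linearMap _ (syzygy R N).injective_subtype)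
  · intro h
    rw [Module.Flat.iff_lTensor_preserves_injective_linearMap]
    intro A B _ _ _ _ f hf
    exact (h (B ⧸ LinearMap.range f)).lTensor_injective hf
      (LinearMap.exact_map_mkQ_range f) (Submodule.mkQ_surjective _)

/-- Dimension shifting between the two variables of `Tor`. -/
theorem torOneVanish_shift [Module.Flat R P] [Module.Flat R Q]
    {i : K →ₗ[R] P} {p : P →ₗ[R] M} (hi : Function.Injective i) (hip : Function.Exact i p)
    (hp : Function.Surjective p)
    {j : L →ₗ[R] Q} {q : Q →ₗ[R] N} (hj : Function.Injective j) (hjq : Function.Exact j q)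
    (hq : Function.Surjective q) : TorOneVanish R K N ↔ TorOneVanish R M L := by
  have hP : Function.Injective (j.lTensor P) :=
    Module.Flat.lTensor_preserves_injective_linearMap _ hj
  have hQ : Function.Injective (i.rTensor Q) :=
    Module.Flat.rTensor_preserves_injective_linearMap _ hi
  have hcomm : i.rTensor Q ∘ j.lTensor K = j.lTensor P ∘ i.rTensor L :=
    funext (rTensor_lTensor_apply i j)
  calc TorOneVanish R K N ↔ Function.Injective (j.lTensor K) :=
        ⟨fun h ↦ h.lTensor_injective hj hjq hq, torOneVanish_of_lTensor_injective hjq hq⟩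
    _ ↔ Function.Injective (i.rTensor L) := by
        rw [← hQ.of_comp_iff, hcomm, hP.of_comp_iff]
    _ ↔ TorOneVanish R M L :=
        ⟨torOneVanish_of_rTensor_injective hip hp, fun h ↦ h.rTensor_injective hi hip hp⟩

theorem torVanish_syzygy_left (k : ℕ) (M N : Type u) [AddCommGroup M] [Module R M]
    [AddCommGroup N] [Module R N] :
    TorVanish R k (syzygy R M) N ↔ TorVanish R k M (syzygy R N) := by
  induction k generalizing M with
  | zero =>
    exact torOneVanish_shift (syzygy R M).injective_subtype syzygy_exact syzygy_surjective
      (syzygy R N).injective_subtype syzygy_exact syzygy_surjective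
  | succ k ih => exact ih (syzygy R M)

theorem torVanish_succ_iff (k : ℕ) : TorVanish R (k + 1) M N ↔ TorVanish R k M (syzygy R N) :=
  torVanish_syzygy_left k M N

theorem torVanish_comm (k : ℕ) (M N : Type u) [AddCommGroup M] [Module R M]
    [AddCommGroup N] [Module R N] : TorVanish R k M N ↔ TorVanish R k N M := by
  induction k generalizing M N with
  | zero => exact ⟨TorOneVanish.symm, TorOneVanish.symm⟩
  | succ k ih => rw [torVanish_succ_iff, ih]; rfl

theorem torVanish_succ_iff_of_exact [Module.Flat R P] (k : ℕ)
    {i : K →ₗ[R] P} {p : P →ₗ[R] M} (hi : Function.Injective i) (hip : Function.Exact i p)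
    (hp : Function.Surjective p) (N : Type u) [AddCommGroup N] [Module R N] :
    TorVanish R (k + 1) M N ↔ TorVanish R k K N := by
  induction k generalizing N with
  | zero =>
    rw [torVanish_succ_iff]
    exact (torOneVanish_shift hi hip hp (syzygy R N).injective_subtype syzygy_exact
      syzygy_surjective).symm
  | succ k ih => rw [torVanish_succ_iff, ih, torVanish_succ_iff]

/-- Dimension shifting is done in `N`, so the retraction itself never has to be lifted to syzygies.
-/
theorem TorVanish.of_retract {k : ℕ} {i : A →ₗ[R] B} {r : B →ₗ[R] A} (h : r ∘ₗ i = .id)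
    (hB : TorVanish R k B N) : TorVanish R k A N := by
  induction k generalizing N with
  | zero =>
    refine torOneVanish_of_lTensor_injective syzygy_exact syzygy_surjective ?_
    have hB' := hB.lTensor_injective (syzygy R N).injective_subtype syzygy_exact syzygy_surjective
    have hi : Function.Injective (i.rTensor (syzygy R N)) := by
      refine Function.LeftInverse.injective (g := r.rTensor _) fun x ↦ ?_
      rw [← LinearMap.comp_apply, ← LinearMap.rTensor_comp, h, LinearMap.rTensor_id,
        LinearMap.id_apply]
    refine Function.Injective.of_comp (f := i.rTensor _) ?_
    rw [show ⇑(i.rTensor _) ∘ (syzygy R N).subtype.lTensor A = _ from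
      funext (rTensor_lTensor_apply i _)]
    exact hB'.comp hi
  | succ k ih =>
    rw [torVanish_succ_iff] at hB ⊢
    exact ih hB

theorem TorVanish.congr {k : ℕ} (e : A ≃ₗ[R] B) (h : TorVanish R k B N) : TorVanish R k A N :=
  h.of_retract (i := e.toLinearMap) (r := e.symm.toLinearMap) (by ext; simp)

/-! ### Fragments of the long exact sequence of `Tor` -/

section LongExactSequence

variable {f : A →ₗ[R] B} {g : B →ₗ[R] C}

theorem TorOneVanish.middle (hf : Function.Injective f) (hfg : Function.Exact f g)
    (hg : Function.Surjective g) (hA : TorOneVanish R A N) (hC : TorOneVanish R C N) :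
    TorOneVanish R B N := by
  refine torOneVanish_of_lTensor_injective syzygy_exact syzygy_surjective ?_
  rw [injective_iff_map_eq_zero]
  intro x hx
  have hx' : g.rTensor (syzygy R N) x = 0 := by
    apply hC.lTensor_injective (syzygy R N).injective_subtype syzygy_exact syzygy_surjective
    rw [← rTensor_lTensor_apply, hx, map_zero, map_zero]
  obtain ⟨a, rfl⟩ := (rTensor_exact _ hfg hg _).1 hx'
  rw [← rTensor_lTensor_apply] at hx
  have ha : (syzygy R N).subtype.lTensor A a = 0 := by
    apply Module.Flat.rTensor_preserves_injective_linearMap (M := FreeCover R N) f hf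
    rw [hx, map_zero]
  have ha' : a = 0 := by
    apply hA.lTensor_injective (syzygy R N).injective_subtype syzygy_exact syzygy_surjective
    rw [ha, map_zero]
  rw [ha', map_zero]

/-- With `L` the syzygy of `N` and `Q` its free cover, `A ⊗ L → A ⊗ Q → B ⊗ Q` equals `A ⊗ L → B ⊗ L
→ B ⊗ Q`. The latter is a composite of injections, since `Tor₁(C, L) = Tor₂(C, N) = 0`. -/
theorem TorOneVanish.left (hf : Function.Injective f) (hfg : Function.Exact f g)
    (hg : Function.Surjective g) (hB : TorOneVanish R B N) (hC : TorOneVanish R C (syzygy R N)) :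
    TorOneVanish R A N := by
  refine torOneVanish_of_lTensor_injective syzygy_exact syzygy_surjective ?_
  refine Function.Injective.of_comp (f := f.rTensor _) ?_
  rw [show ⇑(f.rTensor _) ∘ (syzygy R N).subtype.lTensor A = _ from
    funext (rTensor_lTensor_apply f _)]
  exact (hB.lTensor_injective (syzygy R N).injective_subtype syzygy_exact syzygy_surjective).comp
    (hC.rTensor_injective hf hfg hg)

theorem TorVanish.middle {k : ℕ} (hf : Function.Injective f) (hfg : Function.Exact f g)
    (hg : Function.Surjective g) (hA : TorVanish R k A N) (hC : TorVanish R k C N) :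
    TorVanish R k B N := by
  induction k generalizing N with
  | zero => exact TorOneVanish.middle hf hfg hg hA hC
  | succ k ih =>
    rw [torVanish_succ_iff] at *
    exact ih hA hC

theorem TorVanish.left {k : ℕ} (hf : Function.Injective f) (hfg : Function.Exact f g)
    (hg : Function.Surjective g) (hB : TorVanish R k B N) (hC : TorVanish R (k + 1) C N) :
    TorVanish R k A N := by
  induction k generalizing N with
  | zero =>
    rw [torVanish_succ_iff] at hC
    exact TorOneVanish.left hf hfg hg hB hC
  | succ k ih =>
    rw [torVanish_succ_iff] at *
    exact ih hB hC

/-- Composing the free cover of `B` with `g` presents `C`, and the kernel is an extension of `ker g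
≅ A` by the syzygy of `B`; the middle-term case applies to it. -/
theorem TorVanish.right {k : ℕ} (hf : Function.Injective f) (hfg : Function.Exact f g)
    (hg : Function.Surjective g) (hA : TorVanish R k A N) (hB : TorVanish R (k + 1) B N) :
    TorVanish R (k + 1) C N := by
  let p := g ∘ₗ freeCoverMap R B
  have hp : Function.Surjective p := hg.comp syzygy_surjective
  rw [torVanish_succ_iff_of_exact k (LinearMap.ker p).injective_subtype
    (LinearMap.exact_subtype_ker_map p) hp]
  have hK : syzygy R B ≤ LinearMap.ker p := LinearMap.ker_le_ker_comp _ _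
  let q : LinearMap.ker p →ₗ[R] LinearMap.ker g := (freeCoverMap R B).restrict fun x hx ↦ hx
  have hA' : TorVanish R k (LinearMap.ker g) N :=
    hA.congr ((LinearEquiv.ofInjective f hf).trans
      (LinearEquiv.ofEq _ _ hfg.linearMap_ker_eq.symm)).symm
  refine TorVanish.middle (f := Submodule.inclusion hK) (g := q)
    (Submodule.inclusion_injective hK) ?_ ?_ hB hA'
  · intro x
    constructor
    · intro hx
      exact ⟨⟨x.1, congrArg Subtype.val hx⟩, rfl⟩
    · rintro ⟨y, rfl⟩
      exact Subtype.ext y.2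
  · rintro ⟨b, hb⟩
    obtain ⟨x, rfl⟩ := syzygy_surjective (R := R) b
    exact ⟨⟨x, hb⟩, rfl⟩

end LongExactSequence

theorem torVanish_of_flat [Module.Flat R M] (k : ℕ) : TorVanish R k M N := by
  induction k generalizing N with
  | zero => exact flat_iff_torOneVanish.1 inferInstance N
  | succ k ih => exact (torVanish_succ_iff k).2 ih

/-- If `N` is embedded in an injective module, then vanishing of `Tor` against injective modules
lets one lower the degree in which `Tor` vanishes on all modules. -/
theorem forall_torVanish_of_succ {k : ℕ}
    (hI : ∀ (I : Type u) [AddCommGroup I] [Module R I], Module.Injective R I → TorVanish R k M I)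
    (h : ∀ (N : Type u) [AddCommGroup N] [Module R N], TorVanish R (k + 1) M N)
    (N : Type u) [AddCommGroup N] [Module R N] : TorVanish R k M N := by
  obtain ⟨J⟩ := EnoughInjectives.presentation (ModuleCat.of R N)
  have hJ : Module.Injective R J.J :=
    Module.injective_module_of_injective_object R J.J (inj := J.injective)
  have hf : Function.Injective J.f.hom := (ModuleCat.mono_iff_injective J.f).1 J.mono
  rw [torVanish_comm]
  exact TorVanish.left (B := J.J) (f := J.f.hom) (g := (LinearMap.range J.f.hom).mkQ) hf
    (LinearMap.exact_map_mkQ_range _) (Submodule.mkQ_surjective _)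
    ((torVanish_comm _ _ _).1 (hI _ hJ)) ((torVanish_comm _ _ _).1 (h _))

end TorVanishing

/-! ### Flat and Gorenstein flat resolutions -/

section Resolutions

variable {S : ModuleCat.{u} R → Prop}
variable {K M P : Type u} [AddCommGroup K] [Module R K] [AddCommGroup M] [Module R M]
  [AddCommGroup P] [Module R P]

theorem HasResolutionLE.of_zero (h : HasResolutionLE R S M 0) :
    ∃ X : ModuleCat.{u} R, S X ∧ Nonempty (X ≃ₗ[R] M) := by
  obtain ⟨X, d, ε, hε, h0, -, hX, hX'⟩ := h
  refine ⟨X 0, hX 0 le_rfl, ⟨LinearEquiv.ofBijective ε ⟨?_, hε⟩⟩⟩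
  rw [injective_iff_map_eq_zero]
  intro x hx
  obtain ⟨y, rfl⟩ := (h0 x).1 hx
  have := hX' 1 one_pos
  rw [Subsingleton.elim y 0, map_zero]

theorem HasResolutionLE.of_succ {n : ℕ} (h : HasResolutionLE R S M (n + 1)) :
    ∃ (X : ModuleCat.{u} R) (ε : X →ₗ[R] M), Function.Surjective ε ∧ S X ∧
      HasResolutionLE R S (LinearMap.ker ε) n := by
  obtain ⟨X, d, ε, hε, h0, hd, hX, hX'⟩ := h
  refine ⟨X 0, ε, hε, hX 0 (Nat.zero_le _), fun i ↦ X (i + 1), fun i ↦ d (i + 1),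
    (d 0).codRestrict _ h0.apply_apply_eq_zero, ?_, ?_, fun i ↦ hd (i + 1),
    fun i hi ↦ hX _ (by lia), fun i hi ↦ hX' _ (by lia)⟩
  · rintro ⟨x, hx⟩
    obtain ⟨y, rfl⟩ := (h0 x).1 hx
    exact ⟨y, rfl⟩
  · intro x
    rw [← hd 0 x]
    exact Subtype.ext_iff

theorem hasResolutionLE_zero (h : S (ModuleCat.of R M)) : HasResolutionLE R S M 0 := by
  refine ⟨fun | 0 => ModuleCat.of R M | _ + 1 => ModuleCat.of R PUnit, fun _ ↦ 0, LinearMap.id,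
    Function.surjective_id, ?_, ?_, ?_, ?_⟩
  · intro x
    exact ⟨fun hx ↦ ⟨0, hx.symm⟩, fun ⟨y, hy⟩ ↦ hy.symm⟩
  · intro i x
    exact ⟨fun _ ↦ ⟨0, Subsingleton.elim (α := PUnit) _ _⟩, fun _ ↦ rfl⟩
  · intro i hi
    obtain rfl : i = 0 := by lia
    exact h
  · rintro (_ | i) hi
    · lia
    · exact inferInstanceAs (Subsingleton PUnit)

theorem HasResolutionLE.cons {n : ℕ} {i : K →ₗ[R] P} {p : P →ₗ[R] M}
    (hi : Function.Injective i) (hip : Function.Exact i p) (hp : Function.Surjective p)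
    (hP : S (ModuleCat.of R P)) (hK : HasResolutionLE R S K n) :
    HasResolutionLE R S M (n + 1) := by
  obtain ⟨X, d, ε, hε, h0, hd, hX, hX'⟩ := hK
  refine ⟨fun | 0 => ModuleCat.of R P | j + 1 => X j,
    fun | 0 => i ∘ₗ ε | j + 1 => d j, p, hp, ?_, ?_, ?_, ?_⟩
  · intro x
    refine (hip x).trans ⟨?_, ?_⟩
    · rintro ⟨y, rfl⟩
      obtain ⟨z, rfl⟩ := hε y
      exact ⟨z, rfl⟩
    · rintro ⟨z, rfl⟩
      exact ⟨ε z, rfl⟩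
  · rintro (_ | j)
    · intro x
      exact (map_eq_zero_iff i hi).trans (h0 x)
    · exact hd j
  · rintro (_ | j) hj
    · exact hP
    · exact hX j (by lia)
  · rintro (_ | j) hj
    · lia
    · exact hX' j (by lia)

theorem resolutionDim_le_iff {n : ℕ} :
    resolutionDim R S M ≤ n ↔ ∃ m ≤ n, HasResolutionLE R S M m := by
  constructor
  · intro h
    by_contra! H
    have : ((n + 1 : ℕ) : ℕ∞) ≤ resolutionDim R S M :=
      le_iInf₂ fun m hm ↦ Nat.cast_le.2 (not_le.1 fun hmn ↦ H m hmn hm)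
    have := Nat.cast_le.1 (this.trans h)
    lia
  · rintro ⟨m, hmn, hm⟩
    exact (iInf₂_le m hm).trans (Nat.cast_le.2 hmn)

theorem hasResolutionLE_flat_iff {n : ℕ} :
    HasResolutionLE R (fun X ↦ Module.Flat R X) M n ↔
      ∀ (N : Type u) [AddCommGroup N] [Module R N], TorVanish R n M N := by
  induction n generalizing M with
  | zero =>
    constructor
    · intro h N _ _
      obtain ⟨X, hX, ⟨e⟩⟩ := h.of_zero
      exact (torVanish_of_flat 0).congr e.symm
    · intro h
      exact hasResolutionLE_zero (flat_iff_torOneVanish.2 h)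
  | succ n ih =>
    constructor
    · intro h N _ _
      obtain ⟨X, ε, hε, hX, hK⟩ := h.of_succ
      exact (torVanish_succ_iff_of_exact n (LinearMap.ker ε).injective_subtype
        (LinearMap.exact_subtype_ker_map ε) hε N).2 (ih.1 hK N)
    · intro h
      exact .cons (syzygy R M).injective_subtype syzygy_exact syzygy_surjective
        (inferInstanceAs (Module.Flat R (FreeCover R M))) (ih.2 h)

theorem forall_torVanish_mono {m n : ℕ} (hmn : m ≤ n)
    (h : ∀ (N : Type u) [AddCommGroup N] [Module R N], TorVanish R m M N)
    (N : Type u) [AddCommGroup N] [Module R N] : TorVanish R n M N := by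
  induction n, hmn using Nat.le_induction generalizing N with
  | base => exact h N
  | succ n _ ih => exact (torVanish_succ_iff n).2 (ih _)

theorem flatDim_le_iff {n : ℕ} :
    flatDim R M ≤ n ↔ ∀ (N : Type u) [AddCommGroup N] [Module R N], TorVanish R n M N := by
  refine resolutionDim_le_iff.trans ⟨?_, fun h ↦ ⟨n, le_rfl, hasResolutionLE_flat_iff.2 h⟩⟩
  rintro ⟨m, hmn, hm⟩
  exact forall_torVanish_mono hmn (hasResolutionLE_flat_iff.1 hm)

theorem IsGorensteinFlat.congr {M' : Type u} [AddCommGroup M'] [Module R M'] (e : M' ≃ₗ[R] M)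
    (h : IsGorensteinFlat R M) : IsGorensteinFlat R M' := by
  obtain ⟨F, d, h1, h2, h3, ⟨e'⟩⟩ := h
  exact ⟨F, d, h1, h2, h3, ⟨e.trans e'⟩⟩

/-- A module which is an extension of itself by a flat module, such that `Tor₁` against injective
modules vanishes, is Gorenstein flat: splice the extension into a periodic complex. -/
theorem IsGorensteinFlat.of_selfExtension [Module.Flat R P] {f : M →ₗ[R] P} {g : P →ₗ[R] M}
    (hf : Function.Injective f) (hfg : Function.Exact f g) (hg : Function.Surjective g)
    (hI : ∀ (I : Type u) [AddCommGroup I] [Module R I], Module.Injective R I →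
      TorVanish R 0 M I) : IsGorensteinFlat R M := by
  have splice {X Y : Type u} [AddCommGroup X] [Module R X] [AddCommGroup Y] [Module R Y]
      {φ : X →ₗ[R] Y} {ψ : Y →ₗ[R] X} (hφ : Function.Injective φ) (hφψ : Function.Exact φ ψ)
      (hψ : Function.Surjective ψ) : Function.Exact (φ ∘ₗ ψ) (φ ∘ₗ ψ) := by
    intro y
    refine ((map_eq_zero_iff φ hφ).trans (hφψ y)).trans ⟨?_, ?_⟩
    · rintro ⟨x, rfl⟩
      obtain ⟨z, rfl⟩ := hψ x
      exact ⟨z, rfl⟩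
    · rintro ⟨z, rfl⟩
      exact ⟨ψ z, rfl⟩
  refine ⟨fun _ ↦ ModuleCat.of R P, fun _ ↦ f ∘ₗ g, fun _ ↦ inferInstanceAs (Module.Flat R P),
    fun _ ↦ splice hf hfg hg, fun I _ _ hI' _ ↦ ?_, ⟨?_⟩⟩
  · rw [LinearMap.rTensor_comp]
    exact splice (TorOneVanish.rTensor_injective (hI I hI') hf hfg hg) (rTensor_exact I hfg hg)
      (LinearMap.rTensor_surjective I hg)
  · exact (LinearEquiv.ofInjective f hf).trans
      (LinearEquiv.ofEq _ _ (LinearMap.range_comp_of_range_eq_top f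
        (LinearMap.range_eq_top.2 hg)).symm)

theorem flat_prod [Module.Flat R M] [Module.Flat R P] : Module.Flat R (M × P) :=
  flat_iff_torOneVanish.2 fun N _ _ ↦
    .middle (f := LinearMap.inl R M P) (g := LinearMap.snd R M P) LinearMap.inl_injective .inl_snd
      LinearMap.snd_surjective (flat_iff_torOneVanish.1 inferInstance N)
      (flat_iff_torOneVanish.1 inferInstance N)

theorem IsGorensteinFlat.of_flat [Module.Flat R M] : IsGorensteinFlat R M :=
  have : Module.Flat R (M × M) := flat_prod
  .of_selfExtension (f := LinearMap.inl R M M) (g := LinearMap.snd R M M)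
    LinearMap.inl_injective .inl_snd LinearMap.snd_surjective fun _ _ _ _ ↦ torVanish_of_flat 0

theorem IsGorensteinFlat.torVanish (h : IsGorensteinFlat R M)
    (I : Type u) [AddCommGroup I] [Module R I] (hI : Module.Injective R I) (k : ℕ) :
    TorVanish R k M I := by
  obtain ⟨F, d, hF, hd, hdI, ⟨e⟩⟩ := h
  refine TorVanish.congr e ?_
  clear e
  -- Indices tied by equations avoid casts between the `F i`, since `0` is not syntactically `-2 + 1
  -- + 1`.
  have key : ∀ i j l : ℤ, i + 1 = j → j + 1 = l →
      TorVanish R k (LinearMap.range (d l)) I := by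
    rintro i _ _ rfl rfl
    induction k generalizing i with
    | zero =>
      refine torOneVanish_of_rTensor_injective (P := F (i + 1 + 1))
        (i := (LinearMap.range (d (i + 1))).subtype) (p := (d (i + 1 + 1)).rangeRestrict)
        ?_ (LinearMap.surjective_rangeRestrict _) ?_
      · intro x
        exact (Subtype.ext_iff.trans (hd (i + 1) x)).trans (by simp)
      · rw [injective_iff_map_eq_zero]
        intro x hx
        obtain ⟨y, rfl⟩ :=
          LinearMap.rTensor_surjective I (LinearMap.surjective_rangeRestrict (d (i + 1))) x
        have hy : (d (i + 1)).rTensor I y = 0 := by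
          rw [← LinearMap.comp_apply, ← LinearMap.rTensor_comp] at hx
          exact hx
        -- Exactness after tensoring makes `y` a boundary, which the map onto the range of `d (i +
        -- 1)` kills.
        obtain ⟨z, rfl⟩ := (hdI I hI i y).1 hy
        rw [← LinearMap.comp_apply, ← LinearMap.rTensor_comp]
        have : (d (i + 1)).rangeRestrict ∘ₗ d i = 0 := by
          ext x
          exact (hd i).apply_apply_eq_zero x
        rw [this, LinearMap.rTensor_zero, LinearMap.zero_apply]
    | succ k ih =>
      refine (torVanish_succ_iff_of_exact (P := F (i + 1 + 1)) k
        (i := (LinearMap.range (d (i + 1))).subtype) (p := (d (i + 1 + 1)).rangeRestrict)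
        (Submodule.injective_subtype _) ?_ (LinearMap.surjective_rangeRestrict _) I).2 ?_
      · intro x
        exact (Subtype.ext_iff.trans (hd (i + 1) x)).trans (by simp)
      -- Passing to the syzygy moves one place to the left in the complex.
      · have := ih (i - 1)
        rwa [sub_add_cancel] at this
  exact key (-2) (-1) 0 rfl rfl

/-- Gorenstein flat modules have no higher `Tor` against injectives, so each term of the resolution
costs one degree. -/
theorem HasResolutionLE.torVanish {n : ℕ}
    (h : HasResolutionLE R (fun X ↦ IsGorensteinFlat R X) M n)
    (I : Type u) [AddCommGroup I] [Module R I] (hI : Module.Injective R I) (k : ℕ) :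
    TorVanish R (n + k) M I := by
  induction n generalizing M with
  | zero =>
    obtain ⟨X, hX, ⟨e⟩⟩ := h.of_zero
    exact (hX.congr e.symm).torVanish I hI _
  | succ n ih =>
    obtain ⟨X, ε, hε, hX, hK⟩ := h.of_succ
    rw [Nat.succ_add_eq_add_succ]
    exact TorVanish.right (LinearMap.ker ε).injective_subtype
      (LinearMap.exact_subtype_ker_map ε) hε (ih hK) (hX.torVanish I hI _)

theorem gorensteinFlatDim_le_torVanish {n k : ℕ} (h : gorensteinFlatDim R M ≤ n) (hk : n ≤ k)
    (I : Type u) [AddCommGroup I] [Module R I] (hI : Module.Injective R I) :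
    TorVanish R k M I := by
  obtain ⟨m, hm, hM⟩ := resolutionDim_le_iff.1 h
  obtain ⟨j, rfl⟩ := Nat.exists_eq_add_of_le (hm.trans hk)
  exact hM.torVanish I hI j

end Resolutions

/-! ### Self-extensions and comparison with the derived functor -/

section SelfExtensions

variable {M N : Type u} [AddCommGroup M] [Module R M] [AddCommGroup N] [Module R N]

/-- Horseshoe lemma for a self-extension. -/
theorem HasSelfExtension.syzygy {n : ℕ}
    (h : HasSelfExtension R M (fun k ↦ k ≤ ((n + 1 : ℕ) : ℕ∞))) :
    HasSelfExtension R (syzygy R M) (fun k ↦ k ≤ (n : ℕ∞)) := by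
  obtain ⟨F, f, g, hf, hfg, hg, hF⟩ := h
  obtain ⟨σ, hσ⟩ := Module.projective_lifting_property g (freeCoverMap R M) hg
  replace hσ (x) : g (σ x) = freeCoverMap R M x := LinearMap.congr_fun hσ x
  -- The horseshoe cover of `F`; its kernel will be the middle term of the new self-extension.
  let ρ : FreeCover R M × FreeCover R M →ₗ[R] F := (f ∘ₗ freeCoverMap R M).coprod σ
  have hρ (x) : ρ x = f (freeCoverMap R M x.1) + σ x.2 := rfl
  have hρs : Function.Surjective ρ := by
    intro y
    obtain ⟨b, hb⟩ := syzygy_surjective (R := R) (g y)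
    have : g (y - σ b) = 0 := by rw [map_sub, hσ, hb, sub_self]
    obtain ⟨m, hm⟩ := (hfg _).1 this
    obtain ⟨a, rfl⟩ := syzygy_surjective (R := R) m
    exact ⟨(a, b), by rw [hρ, hm, sub_add_cancel]⟩
  have hflat : Module.Flat R (FreeCover R M × FreeCover R M) := flat_prod
  refine ⟨ModuleCat.of R (LinearMap.ker ρ),
    (LinearMap.inl R _ _ ∘ₗ (GorRing.syzygy R M).subtype).codRestrict (LinearMap.ker ρ) ?_,
    (LinearMap.snd R _ _ ∘ₗ (LinearMap.ker ρ).subtype).codRestrict (GorRing.syzygy R M) ?_,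
    ?_, ?_, ?_, ?_⟩
  · rintro ⟨x, hx⟩
    replace hx : freeCoverMap R M x = 0 := hx
    change f (freeCoverMap R M x) + σ 0 = 0
    rw [hx, map_zero, map_zero, add_zero]
  · rintro ⟨x, hx⟩
    replace hx : f (freeCoverMap R M x.1) + σ x.2 = 0 := hx
    change freeCoverMap R M x.2 = 0
    have hgx := congrArg g hx
    rwa [map_add, hfg.apply_apply_eq_zero, zero_add, hσ, map_zero] at hgx
  · intro x y hxy
    exact Subtype.ext (congrArg (fun z ↦ z.1.1) hxy)
  · rintro ⟨⟨a, b⟩, hx⟩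
    constructor
    · intro h
      obtain rfl : b = 0 := congrArg Subtype.val h
      replace hx : f (freeCoverMap R M a) + σ 0 = 0 := hx
      rw [map_zero, add_zero, map_eq_zero_iff f hf] at hx
      exact ⟨⟨a, hx⟩, rfl⟩
    · rintro ⟨y, hy⟩
      exact Subtype.ext (congrArg (fun z ↦ z.1.2) hy).symm
  · rintro ⟨b, hb⟩
    replace hb : freeCoverMap R M b = 0 := hb
    rw [← hσ] at hb
    obtain ⟨m, hm⟩ := (hfg _).1 hb
    obtain ⟨a, rfl⟩ := syzygy_surjective (R := R) m
    refine ⟨⟨(-a, b), ?_⟩, rfl⟩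
    change f (freeCoverMap R M (-a)) + σ b = 0
    rw [map_neg, map_neg, hm, neg_add_cancel]
  · refine flatDim_le_iff.2 fun N _ _ ↦ ?_
    exact (torVanish_succ_iff_of_exact n (LinearMap.ker ρ).injective_subtype
      (LinearMap.exact_subtype_ker_map ρ) hρs N).1 (flatDim_le_iff.1 hF N)

theorem HasSelfExtension.hasResolutionLE {n : ℕ}
    (h : HasSelfExtension R M (fun k ↦ k ≤ (n : ℕ∞)))
    (hI : ∀ (I : Type u) [AddCommGroup I] [Module R I], Module.Injective R I →
      TorVanish R n M I) :
    HasResolutionLE R (fun X ↦ IsGorensteinFlat R X) M n := by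
  induction n generalizing M with
  | zero =>
    obtain ⟨F, f, g, hf, hfg, hg, hF⟩ := h
    have : Module.Flat R F := flat_iff_torOneVanish.2 (flatDim_le_iff.1 hF)
    exact hasResolutionLE_zero (.of_selfExtension hf hfg hg hI)
  | succ n ih =>
    -- `hI` passes to the syzygy by definition of `TorVanish`.
    exact .cons (GorRing.syzygy R M).injective_subtype syzygy_exact syzygy_surjective
      (IsGorensteinFlat.of_flat (M := FreeCover R M)) (ih h.syzygy hI)

/-- A self-extension of an injective module splits. -/
theorem HasSelfExtension.torVanish_of_injective {n : ℕ} (hM : Module.Injective R M)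
    (h : HasSelfExtension R M (fun k ↦ k ≤ (n : ℕ∞)))
    (N : Type u) [AddCommGroup N] [Module R N] : TorVanish R n M N := by
  obtain ⟨F, f, g, hf, -, -, hF⟩ := h
  obtain ⟨r, hr⟩ := hM.out f hf LinearMap.id
  exact (flatDim_le_iff.1 hF N).of_retract (LinearMap.ext hr)

/-- Replacing `M` by `ker ε` and truncating the resolution reduces to degree one, where `d 0`
factors through `ker ε` and the inclusion stays injective after tensoring. -/
theorem lTensor_exact_of_torVanish {n : ℕ} {X : ℕ → Type u} [∀ i, AddCommGroup (X i)]
    [∀ i, Module R (X i)] [∀ i, Module.Flat R (X i)] {d : ∀ i, X (i + 1) →ₗ[R] X i}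
    {ε : X 0 →ₗ[R] M} (hε : Function.Surjective ε) (h0 : Function.Exact (d 0) ε)
    (hd : ∀ i, Function.Exact (d (i + 1)) (d i)) (h : TorVanish R n M N) :
    Function.Exact ((d (n + 1)).lTensor N) ((d n).lTensor N) := by
  let d' : X 1 →ₗ[R] LinearMap.ker ε := (d 0).codRestrict _ h0.apply_apply_eq_zero
  have hd's : Function.Surjective d' := by
    rintro ⟨x, hx⟩
    obtain ⟨y, rfl⟩ := (h0 x).1 hx
    exact ⟨y, rfl⟩
  have hd' : Function.Exact (d 1) d' := by
    intro x
    rw [← hd 0 x]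
    exact Subtype.ext_iff
  induction n generalizing M X with
  | zero =>
    have hK : Function.Injective ((LinearMap.ker ε).subtype.lTensor N) :=
      h.symm.lTensor_injective (LinearMap.ker ε).injective_subtype
        (LinearMap.exact_subtype_ker_map ε) hε
    have hcomp : d 0 = (LinearMap.ker ε).subtype ∘ₗ d' := rfl
    intro x
    rw [hcomp, LinearMap.lTensor_comp, LinearMap.comp_apply, map_eq_zero_iff _ hK]
    exact lTensor_exact N hd' hd's x
  | succ n ih =>
    refine ih (X := fun i ↦ X (i + 1)) (d := fun i ↦ d (i + 1)) (ε := d') hd's hd'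
      (fun i ↦ hd (i + 1))
      ((torVanish_succ_iff_of_exact n (LinearMap.ker ε).injective_subtype
        (LinearMap.exact_subtype_ker_map ε) hε N).1 h) ?_ ?_
    · rintro ⟨x, hx⟩
      obtain ⟨y, rfl⟩ := (hd' x).1 hx
      exact ⟨y, rfl⟩
    · intro x
      rw [← hd 1 x]
      exact Subtype.ext_iff

/-- The arguments swap because `Tor` is derived in its second variable, so `M` is the module being
resolved. -/
theorem TorVanish.subsingleton_tor {n : ℕ} (h : TorVanish R n M N) :
    Subsingleton (((Tor (ModuleCat.{u} R) (n + 1)).obj (ModuleCat.of R N)).obj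
      (ModuleCat.of R M)) := by
  let P := projectiveResolution (ModuleCat.of R M)
  have hP (i : ℕ) : Module.Flat R (P.complex.X i) :=
    have : Module.Projective R (P.complex.X i) :=
      (IsProjective.iff_projective _).2 (P.projective i)
    inferInstance
  have key := lTensor_exact_of_torVanish (X := fun i ↦ P.complex.X i)
    (d := fun i ↦ (P.complex.d (i + 1) i).hom) (ε := (P.π.f 0).hom) (N := N)
    ((ModuleCat.epi_iff_surjective _).1 inferInstance)
    ((ShortComplex.ShortExact.moduleCat_exact_iff_function_exact _).1 P.exact₀)
    (fun i ↦ (ShortComplex.ShortExact.moduleCat_exact_iff_function_exact _).1 (P.exact_succ i)) h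
  apply ModuleCat.subsingleton_of_isZero
  refine Limits.IsZero.of_iso ?_ (P.isoLeftDerivedObj
    ((MonoidalCategory.tensoringLeft (ModuleCat.{u} R)).obj (ModuleCat.of R N)) (n + 1))
  refine (HomologicalComplex.exactAt_iff_isZero_homology _ _).1 ?_
  rw [HomologicalComplex.exactAt_iff' _ (n + 1 + 1) (n + 1) n (by simp) (by simp),
    ShortComplex.ShortExact.moduleCat_exact_iff_function_exact]
  exact key

theorem torVanish_of_forall_hasSelfExtension {n : ℕ}
    (h : ∀ (M : Type u) [AddCommGroup M] [Module R M],
      HasSelfExtension R M (fun k ↦ k ≤ (n : ℕ∞)))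
    (M I : Type u) [AddCommGroup M] [Module R M] [AddCommGroup I] [Module R I]
    (hI : Module.Injective R I) : TorVanish R n M I :=
  (torVanish_comm _ _ _).1 ((h I).torVanish_of_injective hI M)

theorem isWeaklyStronglyGorenstein_iff {n : ℕ} :
    IsWeaklyStronglyGorenstein R n ↔ ∀ (M : Type u) [AddCommGroup M] [Module R M],
      HasSelfExtension R M (fun k ↦ k ≤ (n : ℕ∞)) :=
  ⟨fun h M _ _ ↦ (h M).1, fun h M _ _ ↦
    ⟨h M, fun I _ _ hI ↦ ((h I).torVanish_of_injective hI M).subsingleton_tor⟩⟩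

theorem weakGorensteinGlobalDim_le {n : ℕ}
    (h : ∀ (M : Type u) [AddCommGroup M] [Module R M],
      HasSelfExtension R M (fun k ↦ k ≤ (n : ℕ∞))) : weakGorensteinGlobalDim R ≤ n :=
  iSup_le fun M ↦ resolutionDim_le_iff.2 ⟨n, le_rfl,
    (h M).hasResolutionLE fun I _ _ hI ↦ torVanish_of_forall_hasSelfExtension h M I hI⟩

/-- A module of finite flat dimension has flat dimension at most its Gorenstein flat
dimension. -/
theorem flatDim_le_of_gorensteinFlatDim_le {n : ℕ} (h : gorensteinFlatDim R M ≤ n)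
    (hfin : flatDim R M < ⊤) : flatDim R M ≤ n := by
  obtain ⟨m, hm⟩ := ENat.ne_top_iff_exists.1 hfin.ne
  have hM := flatDim_le_iff.1 hm.ge
  obtain hmn | ⟨j, rfl⟩ := (le_total m n).imp_right Nat.exists_eq_add_of_le
  · exact flatDim_le_iff.2 (forall_torVanish_mono hmn hM)
  · clear hm
    refine flatDim_le_iff.2 ?_
    -- Descent from `n + j` to `n`: `Tor` against injectives vanishes in every degree above `n`.
    induction j with
    | zero => exact hM
    | succ j ih =>
      exact ih (forall_torVanish_of_succ
        (gorensteinFlatDim_le_torVanish h (Nat.le_add_right n j)) hM)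

end SelfExtensions

end GorRing

end

theorem proposition2p2 (R : Type u) [CommRing R] (n : ℕ) :
    -- the three characterizations are equivalent
    List.TFAE [
      GorRing.IsWeaklyStronglyGorenstein R n,
      GorRing.weakGorensteinGlobalDim R ≤ (n : ℕ∞) ∧
        ∀ (M : Type u) [AddCommGroup M] [Module R M],
          GorRing.HasSelfExtension R M (fun k => k < ⊤),
      GorRing.weakGorensteinGlobalDim R < ⊤ ∧
        ∀ (M : Type u) [AddCommGroup M] [Module R M],
          GorRing.HasSelfExtension R M (fun k => k ≤ (n : ℕ∞))] ∧
    -- they imply that every module is the kernel and cokernel in a sequence with fd F at most n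
    (GorRing.IsWeaklyStronglyGorenstein R n →
      ∀ (M : Type u) [AddCommGroup M] [Module R M],
        GorRing.HasSelfExtension R M (fun k => k ≤ (n : ℕ∞))) ∧
    -- over a coherent ring, the converse holds
    (GorRing.IsCoherentRing R →
      (∀ (M : Type u) [AddCommGroup M] [Module R M],
        GorRing.HasSelfExtension R M (fun k => k ≤ (n : ℕ∞))) →
      GorRing.IsWeaklyStronglyGorenstein R n) := by
  have lt_top {k : ℕ∞} (hk : k ≤ n) : k < ⊤ := hk.trans_lt (ENat.natCast_lt_top n)
  refine ⟨?_, GorRing.isWeaklyStronglyGorenstein_iff.1,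
    fun _ ↦ GorRing.isWeaklyStronglyGorenstein_iff.2⟩
  tfae_have 1 → 2 := fun h ↦ by
    rw [GorRing.isWeaklyStronglyGorenstein_iff] at h
    refine ⟨GorRing.weakGorensteinGlobalDim_le h, fun M _ _ ↦ ?_⟩
    obtain ⟨F, f, g, hf, hfg, hg, hF⟩ := h M
    exact ⟨F, f, g, hf, hfg, hg, lt_top hF⟩
  tfae_have 2 → 3 := fun ⟨hdim, h⟩ ↦ by
    refine ⟨lt_top hdim, fun M _ _ ↦ ?_⟩
    obtain ⟨F, f, g, hf, hfg, hg, hF⟩ := h M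
    exact ⟨F, f, g, hf, hfg, hg,
      -- The bound on the global dimension is applied to the middle term `F`, not to `M`.
      GorRing.flatDim_le_of_gorensteinFlatDim_le ((le_iSup _ F).trans hdim) hF⟩
  tfae_have 3 → 1 := fun h ↦ GorRing.isWeaklyStronglyGorenstein_iff.2 h.2
  tfae_finish
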